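/- Let $n\ge 1$ and let $\sigma\in\mathfrak S_n$ be a permutation. Draw $\sigma$ in a horizontal strip with $n$ points $1^-,\dots,n^-$ on the bottom boundary, $n$ points $1^+,\dots,n^+$ on the top boundary, and edges joining $i^-$ to $\sigma(i)^+$. Split each point $i^\pm$ into a black point $i_b^\pm$ and, to its right, a white point $i_w^\pm$. Replace each edge by the two edges $(i_b^-,\sigma(i)_w^+)$ and $(i_w^-,\sigma(i)_b^+)$, join $i_w^\pm$ to $(i+1)_b^\pm$ by an arc for $1\le i\le n-1$ (on the bottom and on the top), and join $n_w^+$ to $1_b^-$ by an arc. The result consists of one open path from $1_b^+$ to $n_w^-$, the rank path, and of $\ell\ge 0$ closed cycles. The length of a path or cycle is the number of top arcs $(i_w^+,(i+1)_b^+)$ that it contains. Let $r$ be the length of the rank path and let $\lambda$ be the multiset of the lengths of the $\ell$ cycles. For $I\subseteq[n]$ let $\chi(I)$ be the number of pairs $i<j$ in $I$ with $\sigma(i)<\sigma(j)$ (non-crossing edges), and put $$\overline A(\sigma)=\sum_{I\subseteq[n]}(-1)^{|I|+\chi(I)},\qquad s(\sigma)=\mathrm{Sign}(\overline A(\sigma))\in\{-1,0,1\}.$$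 Then: - the list $\lambda\cup\{r\}$ has an even number of even parts; - $\overline A(\sigma)=\pm 2^{\frac{n+\ell}{2}}$ if the list $\lambda\cup\{r\}$ has no even parts, and $\overline A(\sigma)=0$ otherwise; - consequently $s(\sigma)=2^{-\frac{n+\ell}{2}}\,\overline A(\sigma)$. -/

import Mathlib

/-- The two boundaries of the horizontal strip in which a permutation is drawn:
`i⁻` lies on the bottom boundary and `i⁺` on the top boundary. -/
inductive Side : Type
  | bot
  | top
  deriving DecidableEq

instance : Fintype Side :=
  ⟨{Side.bot, Side.top}, fun x => by cases x <;> simp⟩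

/-- Each endpoint `i^±` is split into a black endpoint and, to its right, a white one. -/
inductive Colour : Type
  | black
  | white
  deriving DecidableEq

instance : Fintype Colour :=
  ⟨{Colour.black, Colour.white}, fun x => by cases x <;> simp⟩

/-- The endpoints `i_b^-, i_w^-, i_b^+, i_w^+` with `i ∈ Fin n` (positions are numbered from `0`). -/
abbrev Endpoint (n : ℕ) : Type := Fin n × Side × Colour

namespace Rauzy

open Side Colour

/-- `Link σ x y`: the edges and arcs of the doubled diagram of `σ`. -/
inductive Link {n : ℕ} (σ : Equiv.Perm (Fin n)) : Endpoint n → Endpoint n → Prop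
  /-- the edge `(i_b^-, σ(i)_w^+)` -/
  | edgeBlack (i : Fin n) : Link σ (i, bot, black) (σ i, top, white)
  /-- the edge `(i_w^-, σ(i)_b^+)` -/
  | edgeWhite (i : Fin n) : Link σ (i, bot, white) (σ i, top, black)
  /-- the arc joining `i_w^±` and `(i+1)_b^±`, at the bottom and at the top -/
  | arc (s : Side) (i j : Fin n) (h : i.val + 1 = j.val) : Link σ (i, s, white) (j, s, black)
  /-- the `-1` mark: the arc joining the last white endpoint of the top boundary and the first
  black endpoint of the bottom boundary -/
  | mark (i j : Fin n) (hi : i.val + 1 = n) (hj : j.val = 0) :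
      Link σ (i, top, white) (j, bot, black)

/-- The doubled diagram of `σ` as a graph on the endpoints. Only its connected components are used
(for `n = 1` an edge and the `-1` mark join the same two endpoints, which form one component). -/
def diagram {n : ℕ} (σ : Equiv.Perm (Fin n)) : SimpleGraph (Endpoint n) :=
  SimpleGraph.fromRel (Link σ)

/-- The closed cycles and the open path of the doubled diagram: its connected components. -/
abbrev Strand {n : ℕ} (σ : Equiv.Perm (Fin n)) : Type :=
  (diagram σ).ConnectedComponent

/-- The rank path: the strand that contains the top-left endpoint. -/
def rankPath {n : ℕ} [NeZero n] (σ : Equiv.Perm (Fin n)) : Strand σ :=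
  (diagram σ).connectedComponentMk ((0 : Fin n), top, black)

open Classical in
/-- The length of a strand: the number of its top arcs. The top arcs start at the endpoints
`i_w^+` where `i` is not the last position. -/
noncomputable def length {n : ℕ} (σ : Equiv.Perm (Fin n)) (C : Strand σ) : ℕ :=
  (Finset.univ.filter fun i : Fin n =>
    i.val + 1 < n ∧ (diagram σ).connectedComponentMk (i, top, white) = C).card

/-- The rank `r` of `σ`: the length of the rank path. -/
noncomputable def rank {n : ℕ} [NeZero n] (σ : Equiv.Perm (Fin n)) : ℕ :=
  length σ (rankPath σ)

open Classical in
/-- The cycles of `σ`: the strands other than the rank path. -/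
noncomputable def cycles {n : ℕ} [NeZero n] (σ : Equiv.Perm (Fin n)) : Finset (Strand σ) :=
  Finset.univ.erase (rankPath σ)

/-- The cycle structure `λ` of `σ`: the multiset of the lengths of its cycles. -/
noncomputable def cycleStructure {n : ℕ} [NeZero n] (σ : Equiv.Perm (Fin n)) : Multiset ℕ :=
  (cycles σ).val.map (length σ)

/-- The number `ℓ` of cycles of `σ`, not including the rank path. -/
noncomputable def numCycles {n : ℕ} [NeZero n] (σ : Equiv.Perm (Fin n)) : ℕ :=
  (cycles σ).card

/-- `χ(I)`: the number of pairs of non-crossing edges in the set `I` of edges of `σ`, an edge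
being labelled by its bottom endpoint. -/
def chi {n : ℕ} (σ : Equiv.Perm (Fin n)) (I : Finset (Fin n)) : ℕ :=
  ((I ×ˢ I).filter fun p => p.1 < p.2 ∧ σ p.1 < σ p.2).card

/-- The Arf invariant `Ā(σ) = ∑_{I ⊆ [n]} (-1)^(|I| + χ(I))`. -/
def arf {n : ℕ} (σ : Equiv.Perm (Fin n)) : ℤ :=
  ∑ I : Finset (Fin n), (-1 : ℤ) ^ (I.card + chi σ I)

/-- The sign `s(σ) ∈ {-1, 0, 1}` of `σ`: the sign of its Arf invariant. -/
def sgn {n : ℕ} (σ : Equiv.Perm (Fin n)) : ℤ :=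
  Int.sign (arf σ)

end Rauzy

/-
On `(ZMod 2)^n` the exponent `|I| + χ(I)` is a quadratic form `Q`, so `Ā(σ)` is a Gauss sum: its
square is `2^n` times the size of the radical of the polar form if `Q` vanishes on the radical, and
`0` otherwise. List the points of the strip as `1⁺, …, n⁺, 1⁻, …, n⁻`. Then `y` lies in the radical
iff the partial sums of `y` along the list are constant along the strands of the doubled diagram, so
the radical consists of the sums, along the edges, of functions on the `ℓ + 1` strands, modulo
constants. The value of `Q` at the indicator of a strand `C` is found by counting the inversions of
the cyclic permutation that follows `C` through the gaps of the list: the sign of a cycle is known,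
and the outcome is `length C + 1`. Hence `Q` vanishes on the radical iff all lengths are odd, and
the relation among the strands says that `∑ (length C + 1)` is even.
-/

namespace Rauzy

open Side Colour

section GaussSum

variable {R R' M : Type*} [CommRing R] [CommRing R'] [AddCommGroup M] [Module R M]

section

variable [Fintype M]

/-- The Gauss sum of a quadratic form `Q` on a finite module with respect to an additive
character `ψ` of the base ring. -/
def quadraticGaussSum (ψ : AddChar R R') (Q : QuadraticForm R M) : R' :=
  ∑ x, ψ (Q x)

variable [IsDomain R']

theorem sum_addChar_linearMap {ψ : AddChar R R'} (hψ : ψ.IsPrimitive) (f : M →ₗ[R] R)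
    [Decidable (f = 0)] : ∑ x, ψ (f x) = if f = 0 then (Fintype.card M : R') else 0 := by
  classical
  have key : ψ.compAddMonoidHom f.toAddMonoidHom = 0 ↔ f = 0 := by
    refine ⟨fun h => ?_, fun h => by ext; simp [h]⟩
    by_contra hf
    obtain ⟨x, hx⟩ := DFunLike.ne_iff.1 hf
    refine hψ hx (DFunLike.ext _ _ fun r => ?_)
    simpa [mul_comm] using DFunLike.congr_fun h (r • x)
  exact (AddChar.sum_eq_ite (ψ.compAddMonoidHom f.toAddMonoidHom)).trans (if_congr key rfl rfl)

open Classical in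
theorem quadraticGaussSum_mul_quadraticGaussSum_neg {ψ : AddChar R R'} (hψ : ψ.IsPrimitive)
    (Q : QuadraticForm R M) :
    quadraticGaussSum ψ Q * quadraticGaussSum ψ (-Q) =
      Fintype.card M * ∑ y : LinearMap.ker Q.polarBilin, ψ (Q y) := by
  calc quadraticGaussSum ψ Q * quadraticGaussSum ψ (-Q)
      = ∑ z, ∑ y, ψ (Q (y + z)) * ψ (-Q z) := by
        rw [quadraticGaussSum, quadraticGaussSum, Finset.sum_mul_sum, Finset.sum_comm]
        refine Finset.sum_congr rfl fun z _ => ?_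
        exact (Equiv.sum_comp (Equiv.addRight z) fun x => ψ (Q x) * ψ (-Q z)).symm
    _ = ∑ y, ψ (Q y) * ∑ z, ψ (Q.polarBilin y z) := by
        rw [Finset.sum_comm]
        simp only [Finset.mul_sum, ← AddChar.map_add_eq_mul]
        refine Finset.sum_congr rfl fun y _ => Finset.sum_congr rfl fun z _ => ?_
        rw [QuadraticMap.polarBilin_apply_apply, QuadraticMap.polar]
        congr 1; abel
    _ = Fintype.card M * ∑ y : LinearMap.ker Q.polarBilin, ψ (Q y) := by
        simp only [sum_addChar_linearMap hψ, mul_ite, mul_zero, ← LinearMap.mem_ker]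
        rw [← Finset.sum_filter, ← Finset.sum_mul, mul_comm]
        congr 1
        exact (Finset.sum_subtype _ (by simp) _)

end

theorem map_add_of_mem_ker_polarBilin {Q : QuadraticForm R M} {y : M}
    (hy : y ∈ LinearMap.ker Q.polarBilin) (z : M) : Q (y + z) = Q y + Q z := by
  have h : Q.polarBilin y z = 0 := by rw [LinearMap.mem_ker.1 hy, LinearMap.zero_apply]
  rwa [QuadraticMap.polarBilin_apply_apply, QuadraticMap.polar, sub_sub, sub_eq_zero] at h

/-- The restriction of a quadratic form to the kernel of its polar form, where it is additive. -/
def polarKerHom (Q : QuadraticForm R M) : LinearMap.ker Q.polarBilin →+ R :=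
  AddMonoidHom.mk' (fun y => Q y) fun y z => map_add_of_mem_ker_polarBilin y.2 z

end GaussSum

section CharTwo

/-- The nontrivial additive character of the field with two elements. -/
def signChar : AddChar (ZMod 2) ℤ :=
  AddChar.zmodChar 2 (ζ := -1) (by norm_num)

theorem signChar_natCast (k : ℕ) : signChar k = (-1) ^ k :=
  AddChar.zmodChar_apply' _ _

theorem signChar_isPrimitive : signChar.IsPrimitive :=
  AddChar.zmodChar_primitive_of_primitive_root 2 (IsPrimitiveRoot.neg_one 0 (by norm_num))

theorem signChar_injective : Function.Injective signChar := by
  decide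

variable {M : Type*} [AddCommGroup M] [Module (ZMod 2) M] [Fintype M]

open Classical in
theorem quadraticGaussSum_sq (Q : QuadraticForm (ZMod 2) M) :
    quadraticGaussSum signChar Q ^ 2 =
      if ∀ y ∈ LinearMap.ker Q.polarBilin, Q y = 0 then
        (Fintype.card M : ℤ) * Nat.card (LinearMap.ker Q.polarBilin) else 0 := by
  have hneg : -Q = Q := by ext; simp [CharTwo.neg_eq]
  have key : signChar.compAddMonoidHom (polarKerHom Q) = 0 ↔
      ∀ y ∈ LinearMap.ker Q.polarBilin, Q y = 0 :=
    ⟨fun h y hy => signChar_injective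
      ((DFunLike.congr_fun h ⟨y, hy⟩).trans signChar.map_zero_eq_one.symm),
    fun h => DFunLike.ext _ _ fun y : LinearMap.ker Q.polarBilin =>
      (congrArg signChar (h y y.2)).trans signChar.map_zero_eq_one⟩
  have h := quadraticGaussSum_mul_quadraticGaussSum_neg signChar_isPrimitive Q
  rw [hneg, ← sq] at h
  rw [h, ← mul_ite_zero, Nat.card_eq_fintype_card]
  congr 1
  exact (AddChar.sum_eq_ite (signChar.compAddMonoidHom (polarKerHom Q))).trans
    (if_congr key rfl rfl)

end CharTwo

section Concordance

open Equiv.Perm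

variable {α : Type*} [LinearOrder α]

/-- The pairs `p.1 ≤ p.2` in `S` that `π` does not invert. The diagonal is included, so that the
number of concordant pairs is the exponent `|I| + χ(I)` of the Arf invariant. -/
def concordantPairs (π : Equiv.Perm α) (S : Finset α) : Finset (α × α) :=
  (S ×ˢ S).filter fun p => p.1 ≤ p.2 ∧ π p.1 ≤ π p.2

theorem mem_concordantPairs {π : Equiv.Perm α} {S : Finset α} {p : α × α} :
    p ∈ concordantPairs π S ↔ (p.1 ∈ S ∧ p.2 ∈ S) ∧ p.1 ≤ p.2 ∧ π p.1 ≤ π p.2 := by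
  rw [concordantPairs, Finset.mem_filter, Finset.mem_product]

theorem card_concordantPairs_subtypePerm {π : Equiv.Perm α} {S : Finset α}
    (h : ∀ x, π x ∈ S ↔ x ∈ S) :
    (concordantPairs (π.subtypePerm h) Finset.univ).card = (concordantPairs π S).card := by
  refine Finset.card_bij (fun p _ => (p.1, p.2)) (fun p hp => ?_) (fun p _ q _ hpq => ?_)
    fun p hp => ?_
  · exact mem_concordantPairs.2 ⟨⟨p.1.2, p.2.2⟩, (mem_concordantPairs.1 hp).2⟩
  · exact Prod.ext (Subtype.ext (congrArg Prod.fst hpq)) (Subtype.ext (congrArg Prod.snd hpq))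
  · obtain ⟨⟨h₁, h₂⟩, hp⟩ := mem_concordantPairs.1 hp
    exact ⟨(⟨p.1, h₁⟩, ⟨p.2, h₂⟩), mem_concordantPairs.2 ⟨by simp, hp⟩, rfl⟩

variable [Fintype α]

theorem card_concordantPairs_eq_sum (π : Equiv.Perm α) (S : Finset α) :
    (concordantPairs π S).card =
      ∑ x, ∑ y, if (x ∈ S ∧ y ∈ S) ∧ x ≤ y ∧ π x ≤ π y then 1 else 0 := by
  rw [← Fintype.sum_prod_type', ← Finset.card_filter]
  congr 1
  ext p
  rw [mem_concordantPairs, Finset.mem_filter_univ]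

theorem sign_eq_neg_one_pow_card_inversions (π : Equiv.Perm α) :
    sign π = (-1) ^ (Finset.univ.filter fun p : α × α => p.1 < p.2 ∧ π p.2 < π p.1).card := by
  obtain ⟨e⟩ : Nonempty (Fin (Fintype.card α) ≃o α) := ⟨Fintype.orderIsoFinOfCardEq α rfl⟩
  calc sign π
      = ∏ i, ∏ j, if e i < e j ∧ π (e j) < π (e i) then -1 else 1 := by
        rw [← sign_permCongr e.symm.toEquiv π, sign_eq_prod_prod_Ioi]
        refine Finset.prod_congr rfl fun i _ => ?_
        rw [← Finset.filter_lt_eq_Ioi, Finset.prod_filter]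
        refine Finset.prod_congr rfl fun j _ => ?_
        have hne : i < j → π (e i) ≠ π (e j) := fun h h' =>
          h.ne (e.injective (π.injective h'))
        have hconj (k) : e.symm.toEquiv.permCongr π k = e.symm (π (e k)) := rfl
        simp only [hconj, OrderIso.lt_iff_lt]
        grind
    _ = ∏ p : α × α, if p.1 < p.2 ∧ π p.2 < π p.1 then -1 else 1 := by
        rw [← Fintype.prod_prod_type']
        exact Equiv.prod_comp (e.toEquiv.prodCongr e.toEquiv) fun p : α × α =>
          if p.1 < p.2 ∧ π p.2 < π p.1 then (-1 : ℤˣ) else 1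
    _ = _ := by rw [Finset.prod_ite, Finset.prod_const, Finset.prod_const_one, mul_one]

theorem card_filter_fst_le_snd :
    (Finset.univ.filter fun p : α × α => p.1 ≤ p.2).card = (Fintype.card α + 1).choose 2 := by
  rw [← Fintype.card_subtype, ← Fintype.card_congr Sym2.sortEquiv, Sym2.card]

theorem sign_mul_neg_one_pow_card_concordantPairs (π : Equiv.Perm α) :
    sign π * (-1) ^ (concordantPairs π Finset.univ).card =
      (-1) ^ (Fintype.card α + 1).choose 2 := by
  rw [sign_eq_neg_one_pow_card_inversions, ← pow_add, ← card_filter_fst_le_snd,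
    ← Finset.card_union_of_disjoint]
  · congr 2
    ext p
    have h : π p.1 = π p.2 ↔ p.1 = p.2 := π.injective.eq_iff
    simp only [Finset.mem_union, Finset.mem_filter_univ, mem_concordantPairs, Finset.mem_univ]
    grind
  · refine Finset.disjoint_left.2 fun p hp hp' => ?_
    exact (mem_concordantPairs.1 hp').2.2.not_gt (Finset.mem_filter.1 hp).2.2

variable [Nonempty α]

theorem sign_of_isCycleOn_univ {π : Equiv.Perm α} (h : π.IsCycleOn Set.univ) :
    sign π = (-1) ^ (Fintype.card α + 1) := by
  obtain hα | hα := subsingleton_or_nontrivial α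
  · rw [Subsingleton.elim π 1, Equiv.Perm.sign_one,
      Fintype.card_eq_one_iff_nonempty_unique.2 ⟨uniqueOfSubsingleton (Classical.arbitrary α)⟩]
    rfl
  · have hcycle : π.IsCycle :=
      isCycle_iff_exists_isCycleOn.2 ⟨_, Set.nontrivial_univ, h, fun x _ => trivial⟩
    have hsupp : π.support = Finset.univ := Finset.eq_univ_iff_forall.2 fun x =>
      mem_support.2 (h.apply_ne Set.nontrivial_univ trivial)
    rw [hcycle.sign, hsupp, Finset.card_univ, pow_succ, mul_neg_one]

theorem card_concordantPairs_univ_of_isCycleOn {π : Equiv.Perm α} (h : π.IsCycleOn Set.univ) :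
    ((concordantPairs π Finset.univ).card : ZMod 2) = (Fintype.card α).choose 2 + 1 := by
  have hsign := sign_mul_neg_one_pow_card_concordantPairs π
  rw [sign_of_isCycleOn_univ h, ← pow_add, Nat.choose_succ_succ, Nat.choose_one_right] at hsign
  have hcast : ((Fintype.card α + 1 + (concordantPairs π Finset.univ).card : ℕ) : ZMod 2) =
      (Fintype.card α + (Fintype.card α).choose 2 : ℕ) := by
    apply signChar_injective
    simpa only [signChar_natCast, Units.val_pow_eq_pow_val, Units.val_neg, Units.val_one] using
      congrArg Units.val hsign
  push_cast at hcast
  linear_combination hcast - CharTwo.two_eq_zero (R := ZMod 2)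

end Concordance

theorem card_concordantPairs_of_isCycleOn {α : Type*} [LinearOrder α] {π : Equiv.Perm α}
    {S : Finset α} (hS : S.Nonempty) (h : π.IsCycleOn S) :
    ((concordantPairs π S).card : ZMod 2) = S.card.choose 2 + 1 := by
  have := hS.to_subtype
  have hmem (x : α) : π x ∈ S ↔ x ∈ S := h.apply_mem_iff
  have hcycle : (π.subtypePerm hmem).IsCycleOn Set.univ := h.subtypePerm
  rw [← card_concordantPairs_subtypePerm hmem, card_concordantPairs_univ_of_isCycleOn hcycle,
    Fintype.card_coe]

theorem natCast_choose_two (k : ℕ) : (k.choose 2 : ZMod 2) = (k / 2 : ℕ) := by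
  rw [ZMod.natCast_eq_natCast_iff]
  have h := Choose.choose_modEq_choose_mod_mul_choose_div_nat (p := 2) (n := k) (k := 2)
  rwa [Nat.mod_self, Nat.choose_zero_right, one_mul, Nat.div_self two_pos,
    Nat.choose_one_right] at h

section ClosingUp

variable {N : ℕ} (τ : Equiv.Perm (Fin N))

/-- The permutation `p ↦ τ p + 1` of `{0, …, N}`, closed up by `N ↦ 0`. -/
def closeUp : Equiv.Perm (Fin (N + 1)) where
  toFun := Fin.lastCases 0 fun p => (τ p).succ
  invFun := Fin.cases (Fin.last N) fun p => (τ.symm p).castSucc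
  left_inv q := by cases q using Fin.lastCases <;> simp
  right_inv q := by cases q using Fin.cases <;> simp

@[simp]
theorem closeUp_castSucc (p : Fin N) : closeUp τ p.castSucc = (τ p).succ :=
  Fin.lastCases_castSucc (motive := fun _ => Fin (N + 1)) p

@[simp]
theorem closeUp_last : closeUp τ (Fin.last N) = 0 :=
  Fin.lastCases_last (motive := fun _ => Fin (N + 1))

-- The last point contributes only its diagonal pair: it is inverted with every other point.
theorem card_concordantPairs_closeUp (S : Finset (Fin (N + 1))) :
    (concordantPairs (closeUp τ) S).card =
      (concordantPairs τ (Finset.univ.filter fun p => p.castSucc ∈ S)).card +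
        if Fin.last N ∈ S then 1 else 0 := by
  simp only [card_concordantPairs_eq_sum, Fin.sum_univ_castSucc, closeUp_castSucc, closeUp_last,
    Fin.castSucc_le_castSucc_iff, Fin.succ_le_succ_iff, Finset.mem_filter_univ,
    (Fin.castSucc_lt_last _).not_ge, (Fin.succ_pos _).not_ge, le_refl, and_false, false_and,
    and_true, and_self, if_false, Finset.sum_const_zero, add_zero, zero_add]

end ClosingUp

theorem apply_perm_eq_of_forall_ne {α β : Type*} [Finite α] {π : Equiv.Perm α} {f : α → β} {e : α}
    (h : ∀ x ≠ e, f (π x) = f x) (x : α) : f (π x) = f x := by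
  by_cases hx : x = e
  swap
  · exact h x hx
  subst hx
  by_contra hne
  have hmaps : Set.MapsTo π {y | f y = f (π x)} {y | f y = f (π x)} := fun y hy =>
    (h y (by rintro rfl; exact hne hy.symm)).trans hy
  obtain ⟨y, hy, hyx⟩ := ((Set.toFinite {y | f y = f (π x)}).injOn_iff_bijOn_of_mapsTo hmaps).1
    π.injective.injOn |>.surjOn rfl
  exact hne (π.injective hyx ▸ hy).symm

section Gaps

variable {n : ℕ} (σ : Equiv.Perm (Fin n))

/-- The involution exchanging the two ends of each edge of `σ`, where the points on the boundary
of the strip are listed as `1⁺, …, n⁺, 1⁻, …, n⁻`. -/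
def otherEnd : Equiv.Perm (Fin (n + n)) :=
  finSumFinEquiv.permCongr ((Equiv.sumComm _ _).trans (Equiv.sumCongr σ σ.symm))

theorem otherEnd_natAdd (i : Fin n) : otherEnd σ (Fin.natAdd n i) = Fin.castAdd n (σ i) := by
  simp [otherEnd, -Fin.natAdd_eq_addNat]

theorem otherEnd_castAdd (k : Fin n) :
    otherEnd σ (Fin.castAdd n k) = Fin.natAdd n (σ.symm k) := by
  simp [otherEnd]

/-- The gaps between consecutive points of the list `1⁺, …, n⁺, 1⁻, …, n⁻`, including those before
the first and after the last. An endpoint is sent to the gap on its side, a black one to the left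
and a white one to the right of its point. -/
def gap : Endpoint n → Fin (n + n + 1)
  | (i, top, black) => (Fin.castAdd n i).castSucc
  | (i, top, white) => (Fin.castAdd n i).succ
  | (i, bot, black) => (Fin.natAdd n i).castSucc
  | (i, bot, white) => (Fin.natAdd n i).succ

theorem gap_white_eq_gap_black {s : Side} {i j : Fin n} (h : i.val + 1 = j.val) :
    gap (i, s, white) = gap (j, s, black) := by
  cases s <;> ext <;> simp [gap] <;> omega

theorem gap_top_white_eq_gap_bot_black {i j : Fin n} (hi : i.val + 1 = n) (hj : j.val = 0) :
    gap (i, top, white) = gap (j, bot, black) := by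
  ext; simp [gap]; omega

/-- The permutation of the gaps that follows the strands along one edge. Its cycle through the
last gap also contains the first one: the rank path is closed up. -/
abbrev turn : Equiv.Perm (Fin (n + n + 1)) :=
  closeUp (otherEnd σ)

theorem sameCycle_gap_of_link {x y : Endpoint n} (h : Link σ x y) :
    (turn σ).SameCycle (gap x) (gap y) := by
  cases h with
  | edgeBlack i =>
    have h : gap (σ i, top, white) = turn σ (gap (i, bot, black)) := by
      simp only [gap, closeUp_castSucc, otherEnd_natAdd]
    rw [h]
    exact Equiv.Perm.SameCycle.rfl.apply_right
  | edgeWhite i =>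
    have h : gap (i, bot, white) = turn σ (gap (σ i, top, black)) := by
      simp only [gap, closeUp_castSucc, otherEnd_castAdd, σ.symm_apply_apply]
    rw [h]
    exact Equiv.Perm.SameCycle.rfl.apply_left
  | arc s i j h => rw [gap_white_eq_gap_black h]
  | mark i j hi hj => rw [gap_top_white_eq_gap_bot_black hi hj]

theorem sameCycle_gap_of_reachable {x y : Endpoint n} (h : (diagram σ).Reachable x y) :
    (turn σ).SameCycle (gap x) (gap y) := by
  obtain ⟨w⟩ := h
  induction w with
  | nil => rfl
  | cons hadj _ ih =>
    rcases (SimpleGraph.fromRel_adj _ _ _).1 hadj with ⟨-, hlink | hlink⟩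
    · exact (sameCycle_gap_of_link σ hlink).trans ih
    · exact (sameCycle_gap_of_link σ hlink).symm.trans ih

/-- The strand of the doubled diagram through an endpoint. -/
abbrev strand (x : Endpoint n) : Strand σ :=
  (diagram σ).connectedComponentMk x

variable {σ} in
theorem strand_eq_of_link {x y : Endpoint n} (h : Link σ x y) : strand σ x = strand σ y := by
  obtain rfl | hne := eq_or_ne x y
  · rfl
  · exact SimpleGraph.ConnectedComponent.connectedComponentMk_eq_of_adj
      ((SimpleGraph.fromRel_adj _ _ _).2 ⟨hne, Or.inl h⟩)

variable [NeZero n]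

theorem gap_surjective : Function.Surjective (gap (n := n)) := by
  intro q
  cases q using Fin.cases with
  | zero => exact ⟨(0, top, black), by ext; simp [gap]⟩
  | succ p =>
    cases p using Fin.addCases with
    | left i => exact ⟨(i, top, white), rfl⟩
    | right i => exact ⟨(i, bot, white), rfl⟩

/-- The strand passing through a gap. -/
def gapStrand : Fin (n + n + 1) → Strand σ :=
  Fin.cases (rankPath σ) (Fin.addCases (fun i => strand σ (i, top, white))
    fun i => strand σ (i, bot, white))

@[simp]
theorem gapStrand_gap (x : Endpoint n) : gapStrand σ (gap x) = strand σ x := by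
  have hn := NeZero.pos n
  obtain ⟨i, s, c⟩ := x
  cases c with
  | white => cases s <;> simp [gap, gapStrand, -Fin.natAdd_eq_addNat]
  | black =>
    obtain hi | ⟨j, hj⟩ : i.val = 0 ∨ ∃ j : Fin n, j.val + 1 = i.val := by
      rcases Nat.eq_zero_or_pos i with hi | hi
      · exact Or.inl hi
      · exact Or.inr ⟨⟨i - 1, by omega⟩, Nat.sub_add_cancel hi⟩
    · cases s with
      | top =>
        obtain rfl : i = 0 := Fin.ext hi
        have hgap : gap (0, top, black) = (0 : Fin (n + n + 1)) := by ext; simp [gap]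
        rw [hgap]
        rfl
      | bot =>
        let k : Fin n := ⟨n - 1, by omega⟩
        have hk : k.val + 1 = n := Nat.sub_add_cancel hn
        rw [← gap_top_white_eq_gap_bot_black hk hi, ← strand_eq_of_link (.mark k i hk hi)]
        simp [gap, gapStrand]
    · rw [← gap_white_eq_gap_black hj, ← strand_eq_of_link (.arc s j i hj)]
      cases s <;> simp [gap, gapStrand, -Fin.natAdd_eq_addNat]

theorem gapStrand_surjective : Function.Surjective (gapStrand σ) := fun C => by
  obtain ⟨x, rfl⟩ := C.exists_rep
  exact ⟨gap x, gapStrand_gap σ x⟩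

theorem gapStrand_turn (q : Fin (n + n + 1)) : gapStrand σ (turn σ q) = gapStrand σ q := by
  refine apply_perm_eq_of_forall_ne (e := Fin.last _) (fun q hq => ?_) q
  obtain ⟨p, rfl⟩ := Fin.exists_castSucc_eq.2 hq
  rw [closeUp_castSucc]
  cases p using Fin.addCases with
  | left k =>
    have h := strand_eq_of_link (.edgeWhite (σ := σ) (σ.symm k))
    rw [σ.apply_symm_apply] at h
    simpa only [otherEnd_castAdd, ← gapStrand_gap, gap] using h
  | right i =>
    have h := strand_eq_of_link (.edgeBlack (σ := σ) i)
    simpa only [otherEnd_natAdd, ← gapStrand_gap, gap] using h.symm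

theorem sameCycle_of_gapStrand_eq {q q' : Fin (n + n + 1)} (h : gapStrand σ q = gapStrand σ q') :
    (turn σ).SameCycle q q' := by
  obtain ⟨x, rfl⟩ := gap_surjective q
  obtain ⟨y, rfl⟩ := gap_surjective q'
  rw [gapStrand_gap, gapStrand_gap] at h
  exact sameCycle_gap_of_reachable σ (SimpleGraph.ConnectedComponent.exact h)

end Gaps

section ConcordanceForm

variable {α : Type*} [LinearOrder α] [Fintype α] (π : Equiv.Perm α)

/-- The quadratic form over the field with two elements whose value on the indicator function of
`S` is the parity of the number of concordant pairs in `S`. -/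
def concordanceForm : QuadraticForm (ZMod 2) (α → ZMod 2) :=
  (Matrix.of fun x y => if x ≤ y ∧ π x ≤ π y then 1 else 0).toQuadraticForm'

theorem concordanceForm_apply (f : α → ZMod 2) :
    concordanceForm π f = ∑ x, ∑ y, if x ≤ y ∧ π x ≤ π y then f x * f y else 0 := by
  simp [concordanceForm, Matrix.toQuadraticForm', Matrix.toLinearMap₂'_apply]

theorem concordanceForm_indicator (S : Finset α) :
    concordanceForm π (fun x => if x ∈ S then 1 else 0) = (concordantPairs π S).card := by
  rw [concordanceForm_apply, card_concordantPairs_eq_sum]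
  push_cast
  refine Finset.sum_congr rfl fun x _ => Finset.sum_congr rfl fun y _ => ?_
  grind

theorem polarBilin_concordanceForm_single (f : α → ZMod 2) (x : α) :
    (concordanceForm π).polarBilin f (Pi.single x 1) =
      ∑ y, if (x < y ∧ π x < π y) ∨ (y < x ∧ π y < π x) then f y else 0 := by
  simp only [concordanceForm, Matrix.toQuadraticForm', LinearMap.BilinMap.polarBilin_toQuadraticMap,
    LinearMap.add_apply, LinearMap.flip_apply, Matrix.toLinearMap₂'_apply, smul_eq_mul,
    Pi.single_apply, ite_mul, mul_ite, one_mul, zero_mul, mul_zero, Finset.sum_ite_eq',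
    Finset.mem_univ, if_true, Finset.sum_ite_irrel, Finset.sum_const_zero]
  simp only [Matrix.of_apply, mul_ite, mul_one, mul_zero]
  rw [← Finset.sum_add_distrib]
  refine Finset.sum_congr rfl fun y _ => ?_
  obtain rfl | hne := eq_or_ne x y
  · simp [CharTwo.add_self_eq_zero]
  · have hπ := π.injective.ne hne
    grind

theorem mem_ker_polarBilin_concordanceForm {f : α → ZMod 2} :
    f ∈ LinearMap.ker (concordanceForm π).polarBilin ↔
      ∀ x, ∑ y, (if (x < y ∧ π x < π y) ∨ (y < x ∧ π y < π x) then f y else 0) = 0 := by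
  simp only [← polarBilin_concordanceForm_single, LinearMap.mem_ker]
  refine ⟨fun h x => by rw [h, LinearMap.zero_apply], fun h => ?_⟩
  exact LinearMap.pi_ext' fun x => LinearMap.ext_ring (h x)

theorem card_add_chi {n : ℕ} (σ : Equiv.Perm (Fin n)) (I : Finset (Fin n)) :
    I.card + chi σ I = (concordantPairs σ I).card := by
  rw [chi, ← Finset.diag_card, ← Finset.card_union_of_disjoint]
  · congr 1
    ext p
    have h : σ p.1 = σ p.2 ↔ p.1 = p.2 := σ.injective.eq_iff
    simp only [Finset.mem_union, Finset.mem_diag, Finset.mem_filter, Finset.mem_product,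
      mem_concordantPairs]
    grind
  · refine Finset.disjoint_left.2 fun p hp hp' => ?_
    exact (Finset.mem_filter.1 hp').2.1.ne (Finset.mem_diag.1 hp).2

theorem arf_eq_quadraticGaussSum {n : ℕ} (σ : Equiv.Perm (Fin n)) :
    arf σ = quadraticGaussSum signChar (concordanceForm σ) := by
  refine Finset.sum_bij' (fun I _ x => if x ∈ I then 1 else 0)
    (fun f _ => Finset.univ.filter fun x => f x = 1) (by simp) (by simp) (by simp)
    (fun f _ => ?_) fun I _ => ?_
  · ext x
    simp only [Finset.mem_filter_univ]
    generalize f x = a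
    revert a; decide
  · rw [card_add_chi, concordanceForm_indicator, signChar_natCast]

end ConcordanceForm

theorem partialSum_eq_sum_ite {N : ℕ} {A : Type*} [AddCommMonoid A] (f : Fin N → A)
    (q : Fin (N + 1)) : Fin.partialSum f q = ∑ p, if p.castSucc < q then f p else 0 := by
  induction q using Fin.induction with
  | zero => simp
  | succ q ih =>
    have h (p : Fin N) : (if p.castSucc < q.succ then f p else 0) =
        (if p.castSucc < q.castSucc then f p else 0) + if p = q then f p else 0 := by
      rcases lt_trichotomy p q with hp | rfl | hp
      · simp [hp, hp.le, hp.ne, Fin.castSucc_lt_succ_iff]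
      · simp
      · simp [hp.not_gt, hp.not_ge, hp.ne', Fin.castSucc_lt_succ_iff]
    simp only [Fin.partialSum_succ, ih, h, Finset.sum_add_distrib, Finset.sum_ite_eq',
      Finset.mem_univ, if_true]

section Radical

variable {n : ℕ} (σ : Equiv.Perm (Fin n))

/-- A function on the edges of `σ`, transported to the points `1⁺, …, n⁺, 1⁻, …, n⁻`. -/
def edgeToPoint {A : Type*} (y : Fin n → A) : Fin (n + n) → A :=
  Fin.addCases (y ∘ σ.symm) y

theorem edgeToPoint_castAdd {A : Type*} (y : Fin n → A) (k : Fin n) :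
    edgeToPoint σ y (Fin.castAdd n k) = y (σ.symm k) :=
  Fin.addCases_left k

theorem edgeToPoint_natAdd {A : Type*} (y : Fin n → A) (i : Fin n) :
    edgeToPoint σ y (Fin.natAdd n i) = y i :=
  Fin.addCases_right i

theorem partialSum_edgeToPoint_top {A : Type*} [AddCommMonoid A] (y : Fin n → A) (i : Fin n) :
    Fin.partialSum (edgeToPoint σ y) (Fin.castAdd n (σ i)).castSucc =
      ∑ j, if σ j < σ i then y j else 0 := by
  rw [partialSum_eq_sum_ite, Fin.sum_univ_add, ← Equiv.sum_comp σ]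
  have h (j k : Fin n) : ¬ n + j.val < k := by omega
  simp only [edgeToPoint_castAdd, edgeToPoint_natAdd, σ.symm_apply_apply, Fin.lt_def,
    Fin.val_castSucc, Fin.val_castAdd, Fin.val_natAdd, h,
    if_false, Finset.sum_const_zero, add_zero]

theorem partialSum_edgeToPoint_bot {A : Type*} [AddCommMonoid A] (y : Fin n → A) (i : Fin n) :
    Fin.partialSum (edgeToPoint σ y) (Fin.natAdd n i).castSucc =
      ∑ j, (y j + if j < i then y j else 0) := by
  rw [partialSum_eq_sum_ite, Fin.sum_univ_add, ← Equiv.sum_comp σ, Finset.sum_add_distrib]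
  have h (j k : Fin n) : j.val < n + k := by omega
  simp only [edgeToPoint_castAdd, edgeToPoint_natAdd, σ.symm_apply_apply, Fin.lt_def,
    Fin.val_castSucc, Fin.val_castAdd, Fin.val_natAdd, h,
    if_true, Nat.add_lt_add_iff_left]

theorem mem_ker_polarBilin_iff_partialSum {y : Fin n → ZMod 2} :
    y ∈ LinearMap.ker (concordanceForm σ).polarBilin ↔
      ∀ p, Fin.partialSum (edgeToPoint σ y) (otherEnd σ p).succ =
        Fin.partialSum (edgeToPoint σ y) p.castSucc := by
  have hpolar (i : Fin n) :
      ∑ j, (if (i < j ∧ σ i < σ j) ∨ (j < i ∧ σ j < σ i) then y j else 0) =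
        Fin.partialSum (edgeToPoint σ y) (Fin.castAdd n (σ i)).castSucc +
          Fin.partialSum (edgeToPoint σ y) (Fin.natAdd n i).castSucc + y i := by
    rw [← Fintype.sum_ite_eq i y]
    simp only [partialSum_edgeToPoint_top, partialSum_edgeToPoint_bot,
      ← Finset.sum_add_distrib]
    refine Finset.sum_congr rfl fun j _ => ?_
    have h : σ i = σ j ↔ i = j := σ.injective.eq_iff
    grind [CharTwo.add_self_eq_zero (y j)]
  simp only [mem_ker_polarBilin_concordanceForm, hpolar]
  rw [Fin.forall_fin_add, and_congr_left' σ.surjective.forall, ← forall_and]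
  refine forall_congr' fun i => ?_
  rw [otherEnd_castAdd, otherEnd_natAdd, Fin.partialSum_succ, Fin.partialSum_succ,
    edgeToPoint_castAdd, edgeToPoint_natAdd, σ.symm_apply_apply]
  grind

/-- The linear map adding up, on each edge of `σ`, the values on the two strands that follow it. -/
def edgeSum : (Strand σ → ZMod 2) →ₗ[ZMod 2] (Fin n → ZMod 2) :=
  LinearMap.funLeft _ _ (fun i => strand σ (i, bot, white)) +
    LinearMap.funLeft _ _ fun i => strand σ (i, bot, black)

theorem edgeSum_apply (g : Strand σ → ZMod 2) (i : Fin n) :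
    edgeSum σ g i = g (strand σ (i, bot, white)) + g (strand σ (i, bot, black)) :=
  rfl

variable [NeZero n]

theorem edgeToPoint_edgeSum (g : Strand σ → ZMod 2) (p : Fin (n + n)) :
    edgeToPoint σ (edgeSum σ g) p =
      g (gapStrand σ p.succ) + g (gapStrand σ p.castSucc) := by
  cases p using Fin.addCases with
  | left k =>
    have hw := strand_eq_of_link (.edgeWhite (σ := σ) (σ.symm k))
    have hb := strand_eq_of_link (.edgeBlack (σ := σ) (σ.symm k))
    rw [σ.apply_symm_apply] at hw hb
    rw [edgeToPoint_castAdd, edgeSum_apply, hw, hb, add_comm, ← gapStrand_gap, ← gapStrand_gap]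
    rfl
  | right i =>
    rw [edgeToPoint_natAdd, edgeSum_apply, ← gapStrand_gap, ← gapStrand_gap]
    rfl

theorem partialSum_edgeToPoint_edgeSum (g : Strand σ → ZMod 2) (q : Fin (n + n + 1)) :
    Fin.partialSum (edgeToPoint σ (edgeSum σ g)) q = g (gapStrand σ q) + g (rankPath σ) := by
  induction q using Fin.induction with
  | zero => exact (CharTwo.add_self_eq_zero _).symm
  | succ p ih =>
    rw [Fin.partialSum_succ, ih, edgeToPoint_edgeSum]
    grind

theorem exists_eq_comp_gapStrand {A : Type*} [Nonempty A] {f : Fin (n + n + 1) → A}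
    (h : ∀ q, f (turn σ q) = f q) : ∃ g, f = g ∘ gapStrand σ := by
  refine (Function.factorsThrough_iff f).1 fun q q' hqq' => ?_
  obtain ⟨k, -, rfl⟩ := (sameCycle_of_gapStrand_eq σ hqq').exists_pow_eq'
  have hf : Function.Semiconj f (turn σ) id := h
  simpa only [Function.iterate_id, id, Equiv.Perm.iterate_eq_pow] using
    ((hf.iterate_right k) q).symm

theorem range_edgeSum :
    LinearMap.range (edgeSum σ) = LinearMap.ker (concordanceForm σ).polarBilin := by
  ext y
  rw [mem_ker_polarBilin_iff_partialSum]
  constructor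
  · rintro ⟨g, rfl⟩ p
    rw [partialSum_edgeToPoint_edgeSum, partialSum_edgeToPoint_edgeSum, ← closeUp_castSucc,
      gapStrand_turn]
  · intro h
    have hturn (q) : Fin.partialSum (edgeToPoint σ y) (turn σ q) =
        Fin.partialSum (edgeToPoint σ y) q := by
      refine apply_perm_eq_of_forall_ne (e := Fin.last _) (fun q hq => ?_) q
      obtain ⟨p, rfl⟩ := Fin.exists_castSucc_eq.2 hq
      rw [closeUp_castSucc, h]
    obtain ⟨g, hg⟩ := exists_eq_comp_gapStrand σ hturn
    refine ⟨g, funext fun i => ?_⟩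
    have hi := Fin.partialSum_right_neg (edgeToPoint σ y) (Fin.natAdd n i)
    rw [hg, edgeToPoint_natAdd, CharTwo.neg_eq, add_comm] at hi
    rw [edgeSum_apply, ← hi, ← gapStrand_gap, ← gapStrand_gap]
    rfl

theorem ker_edgeSum : LinearMap.ker (edgeSum σ) = Submodule.span (ZMod 2) {1} := by
  ext g
  rw [LinearMap.mem_ker, Submodule.mem_span_singleton]
  constructor
  · intro h
    refine ⟨g (rankPath σ), funext fun C => ?_⟩
    obtain ⟨q, rfl⟩ := gapStrand_surjective σ C
    have hq := partialSum_edgeToPoint_edgeSum σ g q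
    have hzero (p) : edgeToPoint σ (0 : Fin n → ZMod 2) p = 0 := by
      cases p using Fin.addCases with
      | left k => rw [edgeToPoint_castAdd, Pi.zero_apply]
      | right i => rw [edgeToPoint_natAdd, Pi.zero_apply]
    simp only [h, partialSum_eq_sum_ite, hzero, ite_self, Finset.sum_const_zero] at hq
    rw [Pi.smul_apply, Pi.one_apply, smul_eq_mul, mul_one]
    exact (CharTwo.add_eq_zero.1 hq.symm).symm
  · rintro ⟨a, rfl⟩
    ext i
    simp [edgeSum_apply, CharTwo.add_self_eq_zero]

theorem cycleStructure_add_rank [Fintype (Strand σ)] :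
    cycleStructure σ + {rank σ} = Finset.univ.val.map (length σ) := by
  classical
  have h : insert (rankPath σ) (cycles σ) = Finset.univ := by
    ext C
    by_cases hC : C = rankPath σ <;> simp [cycles, hC]
  rw [← h, Finset.insert_val_of_notMem (by simp [cycles]), Multiset.map_cons, cycleStructure, rank,
    add_comm, Multiset.singleton_add]

theorem card_strand [Fintype (Strand σ)] : Fintype.card (Strand σ) = numCycles σ + 1 := by
  simpa [cycleStructure, numCycles] using
    (congrArg Multiset.card (cycleStructure_add_rank σ)).symm

theorem card_ker_polarBilin_concordanceForm :
    Nat.card (LinearMap.ker (concordanceForm σ).polarBilin) = 2 ^ numCycles σ := by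
  classical
  have : Fintype (Strand σ) := Fintype.ofFinite _
  have : Nonempty (Strand σ) := ⟨rankPath σ⟩
  have h := (edgeSum σ).finrank_range_add_finrank_ker
  rw [range_edgeSum, ker_edgeSum, finrank_span_singleton one_ne_zero,
    Module.finrank_fintype_fun_eq_card, card_strand, Nat.add_right_cancel_iff] at h
  rw [Module.natCard_eq_pow_finrank (K := ZMod 2), Nat.card_zmod, h]

end Radical

section StrandValue

variable {n : ℕ} (σ : Equiv.Perm (Fin n))

theorem card_concordantPairs_otherEnd (S : Finset (Fin (n + n))) :
    (concordantPairs (otherEnd σ) S).card =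
      (concordantPairs σ (Finset.univ.filter fun i => Fin.natAdd n i ∈ S)).card +
        (concordantPairs σ (Finset.univ.filter fun i => Fin.castAdd n (σ i) ∈ S)).card := by
  have h (j k : Fin n) : ¬ n + j.val ≤ k := by omega
  simp only [card_concordantPairs_eq_sum, Fin.sum_univ_add, Finset.mem_filter_univ,
    otherEnd_natAdd, otherEnd_castAdd, Fin.le_def, Fin.val_natAdd, Fin.val_castAdd, h,
    Nat.add_le_add_iff_left, and_false, false_and, if_false, Finset.sum_const_zero, add_zero,
    zero_add]
  rw [add_comm]
  congr 1
  rw [← Equiv.sum_comp σ]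
  refine Finset.sum_congr rfl fun i _ => ?_
  rw [← Equiv.sum_comp σ]
  refine Finset.sum_congr rfl fun j _ => ?_
  simp only [σ.symm_apply_apply, and_comm (b := i.val ≤ j)]

variable [NeZero n]

open Classical in
theorem card_filter_top_black (C : Strand σ) :
    (Finset.univ.filter fun i => strand σ (i, top, black) = C).card =
      length σ C + if rankPath σ = C then 1 else 0 := by
  obtain ⟨m, rfl⟩ := Nat.exists_eq_succ_of_ne_zero (NeZero.ne n)
  have harc (i : Fin m) : strand σ (i.succ, top, black) = strand σ (i.castSucc, top, white) :=
    (strand_eq_of_link (.arc top _ _ rfl)).symm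
  have hrank : strand σ (0, top, black) = rankPath σ := rfl
  rw [length, Finset.card_filter, Finset.card_filter, Fin.sum_univ_succ, Fin.sum_univ_castSucc,
    add_comm]
  simp [harc, hrank]

open Classical in
theorem card_filter_top_white (C : Strand σ) :
    (Finset.univ.filter fun i => strand σ (i, top, white) = C).card =
      length σ C + if strand σ (0, bot, black) = C then 1 else 0 := by
  obtain ⟨m, rfl⟩ := Nat.exists_eq_succ_of_ne_zero (NeZero.ne n)
  have hmark : strand σ (Fin.last m, top, white) = strand σ (0, bot, black) :=
    strand_eq_of_link (.mark _ _ rfl rfl)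
  rw [length, Finset.card_filter, Finset.card_filter, Fin.sum_univ_castSucc, Fin.sum_univ_castSucc]
  simp [hmark]

theorem gapStrand_last : gapStrand σ (Fin.last (n + n)) = rankPath σ := by
  rw [← gapStrand_turn, closeUp_last]
  rfl

open Classical in
theorem card_filter_gapStrand_div_two (C : Strand σ) :
    (Finset.univ.filter fun q => gapStrand σ q = C).card / 2 =
      length σ C + if rankPath σ = C then 1 else 0 := by
  have hbot : (Finset.univ.filter fun i => strand σ (i, bot, black) = C).card =
      (Finset.univ.filter fun i => strand σ (i, top, white) = C).card := by
    rw [Finset.card_filter, Finset.card_filter,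
      ← Equiv.sum_comp σ fun i => if strand σ (i, top, white) = C then 1 else 0]
    exact Finset.sum_congr rfl fun i _ => by rw [strand_eq_of_link (.edgeBlack i)]
  have hsum : (Finset.univ.filter fun q => gapStrand σ q = C).card =
      (Finset.univ.filter fun i => strand σ (i, top, black) = C).card +
        (Finset.univ.filter fun i => strand σ (i, bot, black) = C).card +
          if rankPath σ = C then 1 else 0 := by
    simp only [Finset.card_filter, Fin.sum_univ_castSucc, Fin.sum_univ_add, gapStrand_last,
      ← gapStrand_gap, gap]
  rw [hsum, hbot, card_filter_top_black, card_filter_top_white]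
  split_ifs <;> omega

theorem isCycleOn_turn (C : Strand σ) : (turn σ).IsCycleOn {q | gapStrand σ q = C} := by
  refine ⟨(turn σ).bijOn fun q => ?_, fun q hq q' hq' =>
    sameCycle_of_gapStrand_eq σ (hq.trans hq'.symm)⟩
  rw [Set.mem_ofPred_eq, Set.mem_ofPred_eq, gapStrand_turn]

open Classical in
theorem concordanceForm_edgeSum_single (C : Strand σ) :
    concordanceForm σ (edgeSum σ (Pi.single C 1)) = length σ C + 1 := by
  let S : Finset (Fin (n + n + 1)) := Finset.univ.filter fun q => gapStrand σ q = C
  let U := Finset.univ.filter fun i => strand σ (i, bot, black) = C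
  let W := Finset.univ.filter fun i => strand σ (i, bot, white) = C
  have hsplit : edgeSum σ (Pi.single C 1) + (fun i => if i ∈ U then 1 else 0) =
      fun i => if i ∈ W then 1 else 0 := by
    ext i
    simp only [Pi.add_apply, edgeSum_apply, Pi.single_apply, U, W, Finset.mem_filter_univ]
    rw [add_assoc, CharTwo.add_self_eq_zero, add_zero]
  have hform := map_add_of_mem_ker_polarBilin
    (range_edgeSum σ ▸ LinearMap.mem_range_self _ (Pi.single C 1)) fun i => if i ∈ U then 1 else 0
  rw [hsplit, concordanceForm_indicator, concordanceForm_indicator] at hform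
  have hturn : (concordantPairs (turn σ) S).card = (concordantPairs σ U).card +
      (concordantPairs σ W).card + if rankPath σ = C then 1 else 0 := by
    simp only [card_concordantPairs_closeUp, card_concordantPairs_otherEnd,
      Finset.mem_filter_univ, S, U, W, gapStrand_last, ← gapStrand_gap, gap,
      strand_eq_of_link (.edgeWhite _)]
  have hcycle : ((concordantPairs (turn σ) S).card : ZMod 2) =
      (length σ C + if rankPath σ = C then 1 else 0 : ℕ) + 1 := by
    rw [card_concordantPairs_of_isCycleOn, natCast_choose_two, card_filter_gapStrand_div_two]
    · obtain ⟨q, hq⟩ := gapStrand_surjective σ C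
      exact ⟨q, (Finset.mem_filter_univ q).2 hq⟩
    · simpa [S] using isCycleOn_turn σ C
  rw [hturn] at hcycle
  push_cast at hcycle
  grind

end StrandValue

section Arf

variable {n : ℕ} [NeZero n] (σ : Equiv.Perm (Fin n))

theorem concordanceForm_edgeSum [Fintype (Strand σ)] (g : Strand σ → ZMod 2) :
    concordanceForm σ (edgeSum σ g) = ∑ C, g C * (length σ C + 1) := by
  classical
  have hmem (g) : edgeSum σ g ∈ LinearMap.ker (concordanceForm σ).polarBilin :=
    range_edgeSum σ ▸ LinearMap.mem_range_self _ g
  let q : (Strand σ → ZMod 2) →ₗ[ZMod 2] ZMod 2 :=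
    (polarKerHom (concordanceForm σ)).toZModLinearMap 2 ∘ₗ (edgeSum σ).codRestrict _ hmem
  calc concordanceForm σ (edgeSum σ g) = q g := rfl
    _ = ∑ C, g C • q (Pi.single C 1) := by
      conv_lhs => rw [← Finset.univ_sum_single g, map_sum]
      refine Finset.sum_congr rfl fun C _ => ?_
      rw [← map_smul, ← Pi.single_smul, smul_eq_mul, mul_one]
    _ = ∑ C, g C * (length σ C + 1) := by
      refine Finset.sum_congr rfl fun C _ => congrArg (g C * ·) ?_
      rw [← concordanceForm_edgeSum_single σ C]
      change concordanceForm σ (edgeSum σ (Pi.single C 1)) = _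
      congr!

theorem forall_mem_ker_concordanceForm_eq_zero_iff :
    (∀ y ∈ LinearMap.ker (concordanceForm σ).polarBilin, concordanceForm σ y = 0) ↔
      ∀ C, Odd (length σ C) := by
  classical
  have : Fintype (Strand σ) := Fintype.ofFinite _
  have hodd (C) : (length σ C + 1 : ZMod 2) = 0 ↔ Odd (length σ C) := by
    rw [← ZMod.natCast_eq_one_iff_odd, CharTwo.add_eq_zero]
  simp only [← range_edgeSum, LinearMap.mem_range, forall_exists_index,
    forall_apply_eq_imp_iff, ← hodd]
  refine ⟨fun h C => ?_, fun h g => ?_⟩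
  · rw [← concordanceForm_edgeSum_single, h]
  · simp only [concordanceForm_edgeSum, h, mul_zero, Finset.sum_const_zero]

theorem forall_mem_cycleStructure_add_rank {P : ℕ → Prop} :
    (∀ k ∈ cycleStructure σ + {rank σ}, P k) ↔ ∀ C, P (length σ C) := by
  have : Fintype (Strand σ) := Fintype.ofFinite _
  simp [cycleStructure_add_rank, -Multiset.mem_add]

theorem even_countP_even : Even ((cycleStructure σ + {rank σ}).countP Even) := by
  classical
  have : Fintype (Strand σ) := Fintype.ofFinite _
  have hone : edgeSum σ 1 = 0 := by
    rw [← LinearMap.mem_ker, ker_edgeSum]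
    exact Submodule.mem_span_singleton_self 1
  have hsum := concordanceForm_edgeSum σ 1
  rw [hone, QuadraticMap.map_zero] at hsum
  rw [cycleStructure_add_rank, Multiset.countP_map, ← Finset.filter_val, Finset.card_val,
    Finset.card_filter, ← ZMod.natCast_eq_zero_iff_even, hsum, Nat.cast_sum]
  refine Finset.sum_congr rfl fun C _ => ?_
  rw [Pi.one_apply, one_mul]
  obtain h | h := Nat.even_or_odd (length σ C)
  · rw [if_pos h, (ZMod.natCast_eq_zero_iff_even).2 h, Nat.cast_one, zero_add]
  · rw [if_neg (Nat.not_even_iff_odd.2 h), (ZMod.natCast_eq_one_iff_odd).2 h]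
    rfl

open Classical in
theorem arf_sq : arf σ ^ 2 =
    if ∀ k ∈ cycleStructure σ + {rank σ}, ¬ Even k then 2 ^ (n + numCycles σ) else 0 := by
  simp only [arf_eq_quadraticGaussSum, quadraticGaussSum_sq, Fintype.card_fun, ZMod.card,
    forall_mem_ker_concordanceForm_eq_zero_iff, card_ker_polarBilin_concordanceForm,
    Fintype.card_fin, forall_mem_cycleStructure_add_rank, Nat.not_even_iff_odd, Nat.cast_pow,
    Nat.cast_two, pow_add]

variable {σ}

theorem arf_eq_or_eq_neg (h : ∀ k ∈ cycleStructure σ + {rank σ}, ¬ Even k) :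
    (arf σ : ℝ) = (2 : ℝ) ^ (((n : ℝ) + (numCycles σ : ℝ)) / 2) ∨
      (arf σ : ℝ) = -(2 : ℝ) ^ (((n : ℝ) + (numCycles σ : ℝ)) / 2) := by
  classical
  have hsq := arf_sq σ
  rw [if_pos h] at hsq
  rw [← sq_eq_sq_iff_eq_or_eq_neg, ← Real.rpow_mul_natCast zero_le_two, Nat.cast_two,
    div_mul_cancel₀ _ two_ne_zero, ← Nat.cast_add, Real.rpow_natCast]
  exact_mod_cast hsq

theorem arf_eq_zero (h : ∃ k ∈ cycleStructure σ + {rank σ}, Even k) : arf σ = 0 := by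
  classical
  have hsq := arf_sq σ
  rw [if_neg (by simpa using h)] at hsq
  exact pow_eq_zero_iff two_ne_zero |>.1 hsq

variable (σ) in
theorem sgn_eq_rpow_neg_mul_arf :
    (sgn σ : ℝ) = (2 : ℝ) ^ (-(((n : ℝ) + (numCycles σ : ℝ)) / 2)) * (arf σ : ℝ) := by
  by_cases h : ∃ k ∈ cycleStructure σ + {rank σ}, Even k
  · rw [sgn, arf_eq_zero h, Int.sign_zero, Int.cast_zero, mul_zero]
  · have hpos : (0 : ℝ) < 2 ^ (((n : ℝ) + (numCycles σ : ℝ)) / 2) :=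
      Real.rpow_pos_of_pos zero_lt_two _
    have habs := (abs_eq hpos.le).2 (arf_eq_or_eq_neg fun k hk hk' => h ⟨k, hk, hk'⟩)
    rw [Real.rpow_neg zero_le_two, eq_inv_mul_iff_mul_eq₀ hpos.ne', ← habs, mul_comm]
    exact_mod_cast Int.sign_mul_abs (arf σ)

end Arf

end Rauzy

theorem theorem2 (n : ℕ) [NeZero n] (σ : Equiv.Perm (Fin n)) :
    Even ((Rauzy.cycleStructure σ + {Rauzy.rank σ}).countP Even) ∧
    ((∀ k ∈ Rauzy.cycleStructure σ + {Rauzy.rank σ}, ¬ Even k) →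
      ((Rauzy.arf σ : ℝ) = (2 : ℝ) ^ (((n : ℝ) + (Rauzy.numCycles σ : ℝ)) / 2) ∨
       (Rauzy.arf σ : ℝ) = -(2 : ℝ) ^ (((n : ℝ) + (Rauzy.numCycles σ : ℝ)) / 2))) ∧
    ((∃ k ∈ Rauzy.cycleStructure σ + {Rauzy.rank σ}, Even k) → Rauzy.arf σ = 0) ∧
    (Rauzy.sgn σ : ℝ) =
      (2 : ℝ) ^ (-(((n : ℝ) + (Rauzy.numCycles σ : ℝ)) / 2)) * (Rauzy.arf σ : ℝ) :=
  ⟨Rauzy.even_countP_even σ, Rauzy.arf_eq_or_eq_neg, Rauzy.arf_eq_zero,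
    Rauzy.sgn_eq_rpow_neg_mul_arf σ⟩
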